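/- **Setting.** Let $N\ge 2$ and let $\mathcal T\in\mathbb R^{d_1\times\cdots\times d_N}$. For $1\le k\le N-1$ let $T^{\langle k\rangle}$ be the $k$-th unfolding, the $(d_1\cdots d_k)\times(d_{k+1}\cdots d_N)$ matrix with entries $T^{\langle k\rangle}(i_1\cdots i_k,\,i_{k+1}\cdots i_N)=\mathcal T(i_1,\dots,i_N)$. Let $r_1,\dots,r_{N-1}$ be nonnegative integers with $r=\max_k r_k\ge 1$. Let $T^{\langle k\rangle}_{r_k}$ be a best approximation of $T^{\langle k\rangle}$ in Frobenius norm among matrices of rank at most $r_k$, with compact SVD $T^{\langle k\rangle}_{r_k}=W_{(k)}\Sigma_{(k)}V_{(k)}^{T}$ (with $r_k$ positive singular values), and put $\epsilon=\max_{1\le k\le N-1}\|T^{\langle k\rangle}-T^{\langle k\rangle}_{r_k}\|_F$. Let $\mathcal E\in\mathbb R^{d_1\times\cdots\times d_N}$ be any measurement error tensor, $\widetilde{\mathcal T}=\mathcal T+\mathcal E$ and $\overline\epsilon=\epsilon+\|\mathcal E\|_F$. For $1\le k\le N-1$ let $I^{\le k}$ be a set of multi-indices $(i_1,\dots,i_k)$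 and $I^{>k}$ a set of multi-indices $(i_{k+1},\dots,i_N)$, with $$\operatorname{rank}\bigl(T^{\langle k\rangle}_{r_k}(I^{\le k},I^{>k})\bigr)=r_k ,$$ let $I^{\le 0}$ and $I^{>N}$ consist of the empty multi-index only, and let $$a=\max_{1\le k\le N-1}\max\Bigl\{\bigl\|[W_{(k)}(I^{\le k},:)]^\dagger\bigr\|,\ \bigl\|[V_{(k)}(I^{>k},:)]^\dagger\bigr\|\Bigr\},\qquad c=\max_{1\le k\le N-1}\bigl\|[\widetilde T^{\langle k\rangle}(I^{\le k},I^{>k})]^\dagger\bigr\| ,$$ where $\|\cdot\|$ is the spectral norm and $A^\dagger$ is the Moore–Penrose pseudoinverse. For $\tau\ge0$ let $A^\dagger_\tau$ be the pseudoinverse of the matrix obtained from $A$ by setting its singular values less than $\tau$ to zero. For thresholds $\tau_1,\dots,\tau_{N-1}\ge 0$ the noisy cross approximation is $$\widehat{\mathcal T}(i_1,\dots,i_N)=\left(\prod_{k=1}^{N-1}\widetilde T(I^{\le k-1},i_k,I^{>k})\,[\widetilde T(I^{\le k},I^{>k})]^\dagger_{\tau_k}\right)\widetilde T(I^{\le N-1},i_N,I^{>N}),$$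 where the product of matrices is taken in increasing order of $k$ and $\widetilde T(I^{\le k-1},i_k,I^{>k})$ is the matrix with entries $\widetilde{\mathcal T}(s,i_k,t)$, $s\in I^{\le k-1}$, $t\in I^{>k}$. **Theorem.** There is a universal constant $C>0$ (independent of $N$, the $d_j$, the tensors, the ranks and the interpolation sets) such that, in every such situation, there are thresholds $\tau_1,\dots,\tau_{N-1}\ge0$ for which $$\|\mathcal T-\widehat{\mathcal T}\|_F\le \Bigl(C\,(a^2r+a^2cr\,\overline\epsilon+a^2c^2\,\overline\epsilon^{2})\Bigr)^{\lceil\log_2N\rceil-1}\cdot C\,\bigl(a^2\overline\epsilon+a^2c\,\overline\epsilon^{2}+a^2c^2\,\overline\epsilon^{p}\bigr)$$ holds both for $p=2$ and for $p=3$. -/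

import Mathlib

noncomputable section

namespace TTCross

open scoped Matrix

/-! ### Matrix norms, singular value decompositions and pseudoinverses -/

section Norms

variable {m n : Type*} [Fintype m] [Fintype n]

open scoped Matrix.Norms.Frobenius in
/-- The Frobenius norm of a real matrix. -/
def frobNorm (A : Matrix m n ℝ) : ℝ := ‖A‖

open scoped Matrix.Norms.L2Operator in
/-- The spectral norm of a real matrix. -/
def specNorm [DecidableEq n] (A : Matrix m n ℝ) : ℝ := ‖A‖

/-- `B` is a best rank-`r` approximation of `A` in the Frobenius norm. -/
def IsBestRankApprox (A : Matrix m n ℝ) (r : ℕ) (B : Matrix m n ℝ) : Prop :=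
  B.rank ≤ r ∧ ∀ X : Matrix m n ℝ, X.rank ≤ r → frobNorm (A - B) ≤ frobNorm (A - X)

/-- `A = W diag(σ) Vᵀ` is a compact singular value decomposition of `A`: the columns of `W` and
of `V` are orthonormal and the `r` singular values are positive. -/
structure IsCompactSVD {r : ℕ} (A : Matrix m n ℝ) (W : Matrix m (Fin r) ℝ) (σ : Fin r → ℝ)
    (V : Matrix n (Fin r) ℝ) : Prop where
  left_orthonormal : Wᵀ * W = 1
  right_orthonormal : Vᵀ * V = 1
  pos : ∀ i, 0 < σ i
  eq : A = W * Matrix.diagonal σ * Vᵀ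

variable [DecidableEq n]

/-- The singular values of `A`, as square roots of the eigenvalues of `Aᵀ A`, with multiplicity. -/
def singVal (A : Matrix m n ℝ) (i : n) : ℝ :=
  √((Matrix.isHermitian_conjTranspose_mul_self A).eigenvalues i)

/-- An orthogonal matrix whose columns are right singular vectors of `A`. -/
def rightSing (A : Matrix m n ℝ) : Matrix n n ℝ :=
  (Matrix.isHermitian_conjTranspose_mul_self A).eigenvectorUnitary

/-- The `τ`-pseudoinverse of `A`: the singular values less than `τ` are set to zero before the
pseudoinverse is taken. With `v i` the right singular vectors of `A`, this is the sum of
`(s i)⁻¹ • v i (u i)ᵀ = ((s i) ^ 2)⁻¹ • v i (v i)ᵀ Aᵀ` over the singular values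
`s i ≥ τ` that are positive (the junk value `0⁻¹ = 0` discards `s i = 0`). -/
def truncPinv (τ : ℝ) (A : Matrix m n ℝ) : Matrix n m ℝ :=
  rightSing A * Matrix.diagonal (fun i => if τ ≤ singVal A i then (singVal A i ^ 2)⁻¹ else 0) *
    (rightSing A)ᵀ * Aᵀ

/-- The Moore–Penrose pseudoinverse. -/
def pinv (A : Matrix m n ℝ) : Matrix n m ℝ := truncPinv 0 A

/-- The `τ`-pseudoinverse can be computed from any compact singular value decomposition. -/
theorem truncPinv_eq_of_svd {r : ℕ} {A : Matrix m n ℝ} {W : Matrix m (Fin r) ℝ}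
    {σ : Fin r → ℝ} {V : Matrix n (Fin r) ℝ} (h : IsCompactSVD A W σ V) (τ : ℝ) :
    truncPinv τ A = V * Matrix.diagonal (fun i => if τ ≤ σ i then (σ i)⁻¹ else 0) * Wᵀ := by
  set hA := Matrix.isHermitian_conjTranspose_mul_self A with hhA
  set R := rightSing A with hR
  have hRR : R * Rᵀ = 1 := by
    have := (Matrix.mem_unitaryGroup_iff).1 hA.eigenvectorUnitary.2
    simpa [hR, rightSing, Matrix.star_eq_conjTranspose] using this
  have hRR' : Rᵀ * R = 1 := mul_eq_one_comm.1 hRR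
  have hAA : Aᵀ * A = V * Matrix.diagonal (fun i => σ i ^ 2) * Vᵀ := by
    have e : Matrix.diagonal (fun i => σ i ^ 2) = Matrix.diagonal σ * (Wᵀ * W) *
        Matrix.diagonal σ := by
      rw [h.left_orthonormal, Matrix.mul_one, Matrix.diagonal_mul_diagonal]
      simp only [pow_two]
    rw [e, h.eq]
    simp only [Matrix.transpose_mul, Matrix.transpose_transpose, Matrix.diagonal_transpose,
      Matrix.mul_assoc]
  have hsp : Aᵀ * A = R * Matrix.diagonal hA.eigenvalues * Rᵀ := by
    have := hA.spectral_theorem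
    rw [Unitary.conjStarAlgAut_apply] at this
    simpa [hR, rightSing, Matrix.star_eq_conjTranspose, Function.comp_def] using this
  have hZ : Matrix.diagonal hA.eigenvalues * (Rᵀ * V) =
      (Rᵀ * V) * Matrix.diagonal (fun i => σ i ^ 2) := by
    have e1 : Rᵀ * (Aᵀ * A) * V = Matrix.diagonal hA.eigenvalues * (Rᵀ * V) := by
      rw [hsp]
      calc Rᵀ * (R * Matrix.diagonal hA.eigenvalues * Rᵀ) * V
          = (Rᵀ * R) * Matrix.diagonal hA.eigenvalues * (Rᵀ * V) := by
            simp only [Matrix.mul_assoc]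
        _ = _ := by rw [hRR', Matrix.one_mul]
    have e2 : Rᵀ * (Aᵀ * A) * V = (Rᵀ * V) * Matrix.diagonal (fun i => σ i ^ 2) := by
      rw [hAA]
      calc Rᵀ * (V * Matrix.diagonal (fun i => σ i ^ 2) * Vᵀ) * V
          = (Rᵀ * V) * Matrix.diagonal (fun i => σ i ^ 2) * (Vᵀ * V) := by
            simp only [Matrix.mul_assoc]
        _ = _ := by rw [h.right_orthonormal, Matrix.mul_one]
    rw [← e1, e2]
  have hf : Matrix.diagonal (fun i => if τ ≤ singVal A i then (singVal A i ^ 2)⁻¹ else 0) *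
      (Rᵀ * V) = (Rᵀ * V) * Matrix.diagonal (fun i => if τ ≤ σ i then (σ i ^ 2)⁻¹ else 0) := by
    ext i j
    have hij := congrFun (congrFun hZ i) j
    rw [Matrix.diagonal_mul, Matrix.mul_diagonal] at hij ⊢
    by_cases hz : (Rᵀ * V) i j = 0
    · simp [hz]
    · have hl : hA.eigenvalues i = σ j ^ 2 := by
        rw [mul_comm] at hij
        exact mul_left_cancel₀ hz hij
      have hs : singVal A i = σ j := by
        change √(hA.eigenvalues i) = σ j
        rw [hl, Real.sqrt_sq (h.pos j).le]
      rw [hs, mul_comm]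
  have hAt : Aᵀ = V * (Matrix.diagonal σ * Wᵀ) := by
    rw [h.eq]
    simp only [Matrix.transpose_mul, Matrix.transpose_transpose, Matrix.diagonal_transpose]
  have hd : Matrix.diagonal (fun i => if τ ≤ σ i then (σ i ^ 2)⁻¹ else 0) * Matrix.diagonal σ =
      Matrix.diagonal (fun i => if τ ≤ σ i then (σ i)⁻¹ else 0) := by
    rw [Matrix.diagonal_mul_diagonal]
    congr 1
    funext i
    have := (h.pos i).ne'
    split_ifs
    · field_simp
    · simp
  rw [truncPinv, ← hR, hAt]
  calc _ = R * (Matrix.diagonal (fun i => if τ ≤ singVal A i then (singVal A i ^ 2)⁻¹ else 0) *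
        (Rᵀ * V)) * (Matrix.diagonal σ * Wᵀ) := by simp only [Matrix.mul_assoc]
    _ = (R * Rᵀ) * V * (Matrix.diagonal (fun i => if τ ≤ σ i then (σ i ^ 2)⁻¹ else 0) *
        Matrix.diagonal σ) * Wᵀ := by rw [hf]; simp only [Matrix.mul_assoc]
    _ = _ := by rw [hRR, Matrix.one_mul, hd]

end Norms

/-! ### Tensors, unfoldings and interpolation sets -/

/-- Real tensors of order `N` and size `d 0 × ⋯ × d (N-1)`. -/
abbrev Tensor {N : ℕ} (d : Fin N → ℕ) : Type := (∀ j, Fin (d j)) → ℝ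

/-- Multi-indices `(i_1, …, i_k)` (the first `k` modes). -/
abbrev LeftIdx {N : ℕ} (d : Fin N → ℕ) (k : ℕ) : Type := ∀ j : {j : Fin N // (j : ℕ) < k}, Fin (d j)

/-- Multi-indices `(i_{k+1}, …, i_N)` (the modes after the `k`-th). -/
abbrev RightIdx {N : ℕ} (d : Fin N → ℕ) (k : ℕ) : Type :=
  ∀ j : {j : Fin N // ¬ (j : ℕ) < k}, Fin (d j)

variable {N : ℕ} {d : Fin N → ℕ}

/-- The Frobenius norm of a tensor. -/
def tensorNorm (T : Tensor d) : ℝ := √(∑ i, T i ^ 2)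

/-- The `k`-th unfolding of `T`, a `(d_1 ⋯ d_k) × (d_{k+1} ⋯ d_N)` matrix. -/
def unfolding (T : Tensor d) (k : ℕ) : Matrix (LeftIdx d k) (RightIdx d k) ℝ :=
  fun a b => T fun j => if h : (j : ℕ) < k then a ⟨j, h⟩ else b ⟨j, h⟩

/-- Interpolation sets: `left k` is a set `I^{≤ k}` of row positions and `right k` a set `I^{> k}` of
column positions of the `k`-th unfolding. Only `1 ≤ k ≤ N - 1` carries information: by convention
`I^{≤ 0}` and `I^{> N}` consist of the empty multi-index. -/
structure InterpolationSets (d : Fin N → ℕ) where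
  left : ∀ k : ℕ, Finset (LeftIdx d k)
  right : ∀ k : ℕ, Finset (RightIdx d k)
  left_zero : left 0 = Finset.univ
  right_last : right N = Finset.univ

namespace InterpolationSets

variable (I : InterpolationSets d)

/-- The rows of `A` with positions in `I^{≤ k}`. -/
def leftRows {k : ℕ} {n : Type*} (A : Matrix (LeftIdx d k) n ℝ) : Matrix (I.left k) n ℝ :=
  A.submatrix Subtype.val id

/-- The rows of `A` with positions in `I^{> k}`. -/
def rightRows {k : ℕ} {n : Type*} (A : Matrix (RightIdx d k) n ℝ) : Matrix (I.right k) n ℝ :=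
  A.submatrix Subtype.val id

/-- The intersection matrix `A(I^{≤ k}, I^{> k})`. -/
def inter {k : ℕ} (A : Matrix (LeftIdx d k) (RightIdx d k) ℝ) : Matrix (I.left k) (I.right k) ℝ :=
  A.submatrix Subtype.val Subtype.val

/-- The sampled slice `T(I^{≤ k}, i_{k+1}, I^{> k+1})`. -/
def slice (T : Tensor d) (i : ∀ j, Fin (d j)) (k : ℕ) :
    Matrix (I.left k) (I.right (k + 1)) ℝ :=
  fun s t => T fun j =>
    if h : (j : ℕ) < k then s.1 ⟨j, h⟩ else
      if h' : (j : ℕ) < k + 1 then i j else t.1 ⟨j, h'⟩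

/-- The partial product
`T(I^{≤ 0}, i_1, I^{> 1}) [T(I^{≤ 1}, I^{> 1})]^†_{τ_1} ⋯ T(I^{≤ k}, i_{k+1}, I^{> k+1})`. -/
def partialProd (T : Tensor d) (τ : ℕ → ℝ) (i : ∀ j, Fin (d j)) :
    ∀ k : ℕ, Matrix (I.left 0) (I.right (k + 1)) ℝ
  | 0 => I.slice T i 0
  | k + 1 => partialProd T τ i k * truncPinv (τ (k + 1)) (I.inter (unfolding T (k + 1))) *
      I.slice T i (k + 1)

/-- The cross approximation of the tensor `T` with thresholds `τ`. The partial product for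
`k = N - 1` is a `1 × 1` matrix, whose entry is the value. -/
def crossApprox (T : Tensor d) (τ : ℕ → ℝ) : Tensor d := fun i =>
  ∑ s, ∑ t, I.partialProd T τ i (N - 1) s t

end InterpolationSets

/-- The maximum of `f k` over `k = 1, …, N - 1`. -/
def cutMax (hN : 2 ≤ N) (f : ℕ → ℝ) : ℝ :=
  (Finset.Icc 1 (N - 1)).sup' (Finset.nonempty_Icc.2 (by omega)) f

end TTCross

end

open TTCross

noncomputable section

namespace TTCross

open scoped Matrix

/-! ### Frobenius and spectral norms -/

section NormLemmas

variable {l m n : Type*} [Fintype l] [Fintype m] [Fintype n]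

/-! Write `T̃ = T + E`. At a cut `m`, two full-size tensors `X`, `Y` are combined into the tensor
whose `m`-th unfolding is `X(:, I^{>m}) K_m Y(I^{≤m}, :)`. These products associate across cuts
(`crossMul_assoc`), so the approximation is a product of `N` copies of `T̃` that may be bracketed
freely (`crossApprox_eq_crossSeg`, `crossSeg_add`). A balanced binary bracketing has `⌈log₂ N⌉`
levels, and every node of it approximates `T̃` itself.

One node is a noisy matrix cross approximation (`frobNorm_sub_cross_le`). Let `A` be the unfolding
of `T̃`, `B` the rank-`r` matrix within `δ` of it, `U` the sampled intersection and `K` its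
truncated pseudoinverse. The SVD of `B` yields interpolation operators of norm at most `a`, so the
sampled columns and rows of `A` are `X U + G` and `U Y + H` with `G`, `H` of size `a δ`. Exact
factors then cost `e = O(a²δ + a²cδ²)`, plus `O(a²(√r (τ + δ) + δ))` for truncation at `τ`. Factors
with error `x` add a linear term and `‖K‖ x²`.

The quadratic term would ruin the recursion, but `‖K‖ ≤ 1/τ`: with `τ = x` it is at most `x`, and
the truncation loss is also controlled linearly in `x`. So each level multiplies the error by at
most a factor `F` (`step_le`). The lowest level combines exact copies with `τ = 0` and costs only
`e`, which is why the exponent is one less than the number of levels. In the dyadic bracketing a cut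
`m` lies at the level given by its 2-adic valuation, so its threshold can be fixed in advance.
Passing from `T̃` back to `T` costs `‖E‖ ≤ δ`. -/

theorem frobNorm_nonneg (A : Matrix m n ℝ) : 0 ≤ frobNorm A := by
  open scoped Matrix.Norms.Frobenius in exact norm_nonneg A

theorem frobNorm_add_le (A B : Matrix m n ℝ) : frobNorm (A + B) ≤ frobNorm A + frobNorm B := by
  open scoped Matrix.Norms.Frobenius in exact norm_add_le A B

theorem frobNorm_sub_le (A B : Matrix m n ℝ) : frobNorm (A - B) ≤ frobNorm A + frobNorm B := by
  open scoped Matrix.Norms.Frobenius in exact norm_sub_le A B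

theorem frobNorm_sub_comm (A B : Matrix m n ℝ) : frobNorm (A - B) = frobNorm (B - A) := by
  open scoped Matrix.Norms.Frobenius in exact norm_sub_rev A B

theorem frobNorm_zero : frobNorm (0 : Matrix m n ℝ) = 0 := by
  open scoped Matrix.Norms.Frobenius in exact norm_zero

theorem frobNorm_transpose (A : Matrix m n ℝ) : frobNorm Aᵀ = frobNorm A := by
  open scoped Matrix.Norms.Frobenius in exact Matrix.frobenius_norm_transpose A

theorem frobNorm_eq_sqrt (A : Matrix m n ℝ) : frobNorm A = √(∑ i, ∑ j, A i j ^ 2) := by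
  open scoped Matrix.Norms.Frobenius in
  have h := Matrix.frobenius_norm_def A
  rw [frobNorm, h, Real.sqrt_eq_rpow]
  simp

theorem frobNorm_sq (A : Matrix m n ℝ) : frobNorm A ^ 2 = ∑ i, ∑ j, A i j ^ 2 := by
  rw [frobNorm_eq_sqrt, Real.sq_sqrt]
  positivity

theorem frobNorm_submatrix_le {m' n' : Type*} [Fintype m'] [Fintype n'] (A : Matrix m n ℝ)
    {f : m' → m} {g : n' → n} (hf : f.Injective) (hg : g.Injective) :
    frobNorm (A.submatrix f g) ≤ frobNorm A := by
  classical
  rw [frobNorm_eq_sqrt, frobNorm_eq_sqrt]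
  apply Real.sqrt_le_sqrt
  calc ∑ i, ∑ j, A (f i) (g j) ^ 2
      = ∑ i ∈ Finset.univ.map ⟨f, hf⟩, ∑ j ∈ Finset.univ.map ⟨g, hg⟩, A i j ^ 2 := by simp
    _ ≤ ∑ i ∈ Finset.univ.map ⟨f, hf⟩, ∑ j, A i j ^ 2 :=
        Finset.sum_le_sum fun i _ => Finset.sum_le_sum_of_subset_of_nonneg
          (Finset.subset_univ _) fun _ _ _ => sq_nonneg _
    _ ≤ ∑ i, ∑ j, A i j ^ 2 := Finset.sum_le_sum_of_subset_of_nonneg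
          (Finset.subset_univ _) fun _ _ _ => Finset.sum_nonneg fun _ _ => sq_nonneg _

theorem specNorm_nonneg [DecidableEq n] (A : Matrix m n ℝ) : 0 ≤ specNorm A := by
  open scoped Matrix.Norms.L2Operator in exact norm_nonneg A

theorem specNorm_add_le [DecidableEq n] (A B : Matrix m n ℝ) :
    specNorm (A + B) ≤ specNorm A + specNorm B := by
  open scoped Matrix.Norms.L2Operator in exact norm_add_le A B

theorem specNorm_sub_le [DecidableEq n] (A B : Matrix m n ℝ) :
    specNorm (A - B) ≤ specNorm A + specNorm B := by
  open scoped Matrix.Norms.L2Operator in exact norm_sub_le A B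

theorem specNorm_eq_zero [DecidableEq n] {A : Matrix m n ℝ} (h : specNorm A = 0) : A = 0 := by
  open scoped Matrix.Norms.L2Operator in exact norm_eq_zero.1 h

theorem specNorm_mul_le [DecidableEq m] [DecidableEq n] (A : Matrix l m ℝ) (B : Matrix m n ℝ) :
    specNorm (A * B) ≤ specNorm A * specNorm B := by
  open scoped Matrix.Norms.L2Operator in exact Matrix.l2_opNorm_mul A B

theorem specNorm_transpose [DecidableEq m] [DecidableEq n] (A : Matrix m n ℝ) :
    specNorm Aᵀ = specNorm A := by
  open scoped Matrix.Norms.L2Operator in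
  have h := Matrix.l2_opNorm_conjTranspose A
  rwa [Matrix.conjTranspose_eq_transpose_of_trivial] at h

theorem specNorm_transpose_mul_self [DecidableEq m] [DecidableEq n] (A : Matrix m n ℝ) :
    specNorm (Aᵀ * A) = specNorm A ^ 2 := by
  open scoped Matrix.Norms.L2Operator in
  have h := Matrix.l2_opNorm_conjTranspose_mul_self A
  rw [Matrix.conjTranspose_eq_transpose_of_trivial, ← pow_two] at h
  exact h

theorem specNorm_diagonal_le [DecidableEq n] {f : n → ℝ} {b : ℝ} (hb : 0 ≤ b)
    (hf : ∀ i, |f i| ≤ b) : specNorm (Matrix.diagonal f) ≤ b := by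
  open scoped Matrix.Norms.L2Operator in
  have h := Matrix.l2_opNorm_diagonal (𝕜 := ℝ) f
  exact h.trans_le ((pi_norm_le_iff_of_nonneg hb).2 hf)

theorem specNorm_one_le [DecidableEq n] : specNorm (1 : Matrix n n ℝ) ≤ 1 := by
  rw [← Matrix.diagonal_one]
  exact specNorm_diagonal_le zero_le_one (by simp)

theorem one_le_specNorm_one [DecidableEq n] [Nonempty n] : 1 ≤ specNorm (1 : Matrix n n ℝ) := by
  have h := specNorm_transpose_mul_self (1 : Matrix n n ℝ)
  rw [Matrix.transpose_one, Matrix.one_mul] at h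
  have h0 : specNorm (1 : Matrix n n ℝ) ≠ 0 := fun h => one_ne_zero (specNorm_eq_zero h)
  have h1 : 0 < specNorm (1 : Matrix n n ℝ) := (specNorm_nonneg _).lt_of_ne' h0
  nlinarith

theorem specNorm_le_one_of_orthonormal [DecidableEq m] [DecidableEq n] {A : Matrix m n ℝ}
    (h : Aᵀ * A = 1) : specNorm A ≤ 1 := by
  have h1 := specNorm_transpose_mul_self A
  rw [h] at h1
  have h2 := specNorm_one_le (n := n)
  nlinarith [specNorm_nonneg A]

theorem specNorm_le_one_of_isProj [DecidableEq n] {P : Matrix n n ℝ} (hs : Pᵀ = P)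
    (hi : P * P = P) : specNorm P ≤ 1 := by
  have h1 := specNorm_transpose_mul_self P
  rw [hs, hi] at h1
  nlinarith [specNorm_nonneg P]

theorem frobNorm_mul_le (A : Matrix l m ℝ) (B : Matrix m n ℝ) :
    frobNorm (A * B) ≤ frobNorm A * frobNorm B := by
  open scoped Matrix.Norms.Frobenius in exact Matrix.frobenius_norm_mul A B

theorem norm_mulVec_le [DecidableEq n] (A : Matrix m n ℝ) (x : n → ℝ) :
    ∑ i, (A *ᵥ x) i ^ 2 ≤ specNorm A ^ 2 * ∑ j, x j ^ 2 := by
  open scoped Matrix.Norms.L2Operator in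
  have h := Matrix.l2_opNorm_mulVec A (WithLp.toLp 2 x)
  have h2 := pow_le_pow_left₀ (norm_nonneg _) h 2
  rw [mul_pow, EuclideanSpace.real_norm_sq_eq, EuclideanSpace.real_norm_sq_eq] at h2
  exact h2

theorem specNorm_le_frobNorm [DecidableEq n] (A : Matrix m n ℝ) : specNorm A ≤ frobNorm A := by
  open scoped Matrix.Norms.L2Operator in
  rw [specNorm, Matrix.l2_opNorm_def]
  refine ContinuousLinearMap.opNorm_le_bound _ (frobNorm_nonneg A) fun x => ?_
  rw [← sq_le_sq₀ (norm_nonneg _) (mul_nonneg (frobNorm_nonneg A) (norm_nonneg x)), mul_pow,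
    EuclideanSpace.real_norm_sq_eq, EuclideanSpace.real_norm_sq_eq]
  have h := pow_le_pow_left₀ (frobNorm_nonneg _)
    (frobNorm_mul_le A (Matrix.of fun j (_ : Unit) => x j)) 2
  rw [mul_pow, frobNorm_sq, frobNorm_sq (Matrix.of fun j (_ : Unit) => x j)] at h
  simpa [Matrix.mul_apply, Matrix.mulVec, dotProduct] using h

/-- Column by column, from the operator norm bound on vectors. -/
theorem frobNorm_mul_le_left [DecidableEq m] (A : Matrix l m ℝ) (B : Matrix m n ℝ) :
    frobNorm (A * B) ≤ specNorm A * frobNorm B := by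
  rw [← abs_of_nonneg (frobNorm_nonneg (A * B)),
    ← abs_of_nonneg (mul_nonneg (specNorm_nonneg A) (frobNorm_nonneg B)), ← sq_le_sq, mul_pow,
    frobNorm_sq, frobNorm_sq, Finset.sum_comm, Finset.sum_comm (f := fun i j => B i j ^ 2),
    Finset.mul_sum]
  exact Finset.sum_le_sum fun j _ => norm_mulVec_le A fun i => B i j

theorem frobNorm_mul_le_right [DecidableEq m] [DecidableEq n] (A : Matrix l m ℝ)
    (B : Matrix m n ℝ) : frobNorm (A * B) ≤ frobNorm A * specNorm B := by
  rw [← frobNorm_transpose, Matrix.transpose_mul, mul_comm, ← frobNorm_transpose A,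
    ← specNorm_transpose B]
  exact frobNorm_mul_le_left _ _

theorem frobNorm_le_sqrt_card_mul_specNorm [DecidableEq n] (A : Matrix m n ℝ) :
    frobNorm A ≤ √(Fintype.card n) * specNorm A := by
  have h := frobNorm_mul_le_left A (1 : Matrix n n ℝ)
  rw [Matrix.mul_one] at h
  have h1 : frobNorm (1 : Matrix n n ℝ) = √(Fintype.card n) := by
    rw [frobNorm_eq_sqrt]
    simp [Matrix.one_apply]
  rwa [h1, mul_comm] at h

theorem specNorm_submatrix_le_one [DecidableEq n] [DecidableEq m] {m' : Type*} [Fintype m']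
    {A : Matrix m n ℝ} (h : Aᵀ * A = 1) {f : m' → m} (hf : f.Injective) :
    specNorm (A.submatrix f id) ≤ 1 := by
  classical
  have e : A.submatrix f id = (1 : Matrix m m ℝ).submatrix f id * A := by
    ext i j
    simp [Matrix.mul_apply, Matrix.one_apply]
  -- The selection matrix has orthonormal rows because `f` is injective, hence norm at most one.
  have hP : (((1 : Matrix m m ℝ).submatrix f id)ᵀ)ᵀ * ((1 : Matrix m m ℝ).submatrix f id)ᵀ = 1 := by
    ext i j
    simp [Matrix.mul_apply, Matrix.one_apply, hf.eq_iff]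
  have h1 := specNorm_le_one_of_orthonormal hP
  rw [specNorm_transpose] at h1
  rw [e]
  calc _ ≤ _ := specNorm_mul_le _ _
    _ ≤ 1 * 1 := mul_le_mul h1 (specNorm_le_one_of_orthonormal h) (specNorm_nonneg _) zero_le_one
    _ = 1 := one_mul 1

end NormLemmas

/-! ### The truncated pseudoinverse -/

section Pinv

variable {m n : Type*} [Fintype m] [Fintype n] [DecidableEq n]

theorem rightSing_mul_transpose (A : Matrix m n ℝ) : rightSing A * (rightSing A)ᵀ = 1 := by
  have := (Matrix.mem_unitaryGroup_iff).1
    (Matrix.isHermitian_conjTranspose_mul_self A).eigenvectorUnitary.2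
  simpa [rightSing, Matrix.star_eq_conjTranspose] using this

theorem rightSing_transpose_mul (A : Matrix m n ℝ) : (rightSing A)ᵀ * rightSing A = 1 :=
  mul_eq_one_comm.1 (rightSing_mul_transpose A)

theorem singVal_nonneg (A : Matrix m n ℝ) (i : n) : 0 ≤ singVal A i := Real.sqrt_nonneg _

theorem singVal_sq (A : Matrix m n ℝ) (i : n) :
    singVal A i ^ 2 = (Matrix.isHermitian_conjTranspose_mul_self A).eigenvalues i :=
  Real.sq_sqrt ((Matrix.posSemidef_conjTranspose_mul_self A).eigenvalues_nonneg i)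

theorem transpose_mul_self_eq (A : Matrix m n ℝ) : Aᵀ * A =
    rightSing A * Matrix.diagonal (fun i => singVal A i ^ 2) * (rightSing A)ᵀ := by
  have := (Matrix.isHermitian_conjTranspose_mul_self A).spectral_theorem
  rw [Unitary.conjStarAlgAut_apply] at this
  rw [funext (singVal_sq A)]
  simpa [rightSing, Matrix.star_eq_conjTranspose, Function.comp_def] using this

/-- The matrix `f(Aᵀ A)`, where `f` is given by its values on the right singular vectors. -/
def rightCalc (A : Matrix m n ℝ) (f : n → ℝ) : Matrix n n ℝ :=
  rightSing A * Matrix.diagonal f * (rightSing A)ᵀ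

theorem rightCalc_mul (A : Matrix m n ℝ) (f g : n → ℝ) :
    rightCalc A f * rightCalc A g = rightCalc A (fun i => f i * g i) := by
  unfold rightCalc
  rw [← Matrix.diagonal_mul_diagonal]
  calc _ = rightSing A * Matrix.diagonal f * ((rightSing A)ᵀ * rightSing A) * Matrix.diagonal g *
        (rightSing A)ᵀ := by simp only [Matrix.mul_assoc]
    _ = _ := by rw [rightSing_transpose_mul, Matrix.mul_one]; simp only [Matrix.mul_assoc]

theorem rightCalc_transpose (A : Matrix m n ℝ) (f : n → ℝ) :
    (rightCalc A f)ᵀ = rightCalc A f := by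
  simp [rightCalc, Matrix.mul_assoc]

theorem rightCalc_one (A : Matrix m n ℝ) : rightCalc A (fun _ => 1) = 1 := by
  rw [rightCalc, Matrix.diagonal_one, Matrix.mul_one, rightSing_mul_transpose]

theorem rightCalc_sub (A : Matrix m n ℝ) (f g : n → ℝ) :
    rightCalc A f - rightCalc A g = rightCalc A (fun i => f i - g i) := by
  simp only [rightCalc, ← Matrix.diagonal_sub, Matrix.mul_sub, Matrix.sub_mul]

theorem transpose_mul_self_eq_rightCalc (A : Matrix m n ℝ) :
    Aᵀ * A = rightCalc A (fun i => singVal A i ^ 2) := transpose_mul_self_eq A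

theorem specNorm_rightCalc_le (A : Matrix m n ℝ) {f : n → ℝ} {b : ℝ} (hb : 0 ≤ b)
    (hf : ∀ i, |f i| ≤ b) : specNorm (rightCalc A f) ≤ b := by
  have h1 := specNorm_le_one_of_orthonormal (rightSing_transpose_mul A)
  have h2 := specNorm_transpose (rightSing A)
  have h3 := specNorm_diagonal_le hb hf
  calc specNorm (rightCalc A f) ≤ specNorm (rightSing A * Matrix.diagonal f) *
        specNorm (rightSing A)ᵀ := specNorm_mul_le _ _
    _ ≤ (1 * b) * 1 := by
        rw [h2]
        refine mul_le_mul ((specNorm_mul_le _ _).trans ?_) h1 (specNorm_nonneg _) (by simpa)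
        exact mul_le_mul h1 h3 (specNorm_nonneg _) zero_le_one
    _ = b := by ring

theorem truncPinv_eq_rightCalc (τ : ℝ) (A : Matrix m n ℝ) : truncPinv τ A =
    rightCalc A (fun i => if τ ≤ singVal A i then (singVal A i ^ 2)⁻¹ else 0) * Aᵀ := rfl

theorem truncPinv_mul_self (τ : ℝ) (A : Matrix m n ℝ) : truncPinv τ A * A =
    rightCalc A (fun i => if τ ≤ singVal A i ∧ singVal A i ≠ 0 then 1 else 0) := by
  rw [truncPinv_eq_rightCalc, Matrix.mul_assoc, transpose_mul_self_eq_rightCalc, rightCalc_mul]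
  congr 1
  funext i
  by_cases h : τ ≤ singVal A i <;> by_cases h' : singVal A i = 0 <;> simp [h, h']

theorem specNorm_truncPinv_mul_self_le (τ : ℝ) (A : Matrix m n ℝ) :
    specNorm (truncPinv τ A * A) ≤ 1 := by
  rw [truncPinv_mul_self]
  refine specNorm_rightCalc_le A zero_le_one fun i => ?_
  split_ifs <;> simp

theorem transpose_mul_truncPinv (τ : ℝ) (A : Matrix m n ℝ) :
    (A * truncPinv τ A)ᵀ = A * truncPinv τ A := by
  rw [truncPinv_eq_rightCalc, Matrix.transpose_mul, Matrix.transpose_mul, rightCalc_transpose,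
    Matrix.transpose_transpose, Matrix.mul_assoc]

theorem mul_truncPinv_mul_self (τ : ℝ) (A : Matrix m n ℝ) :
    A * truncPinv τ A * (A * truncPinv τ A) = A * truncPinv τ A := by
  rw [Matrix.mul_assoc, ← Matrix.mul_assoc (truncPinv τ A), truncPinv_mul_self,
    truncPinv_eq_rightCalc, ← Matrix.mul_assoc (rightCalc A _), rightCalc_mul]
  congr 3
  funext i
  by_cases h : τ ≤ singVal A i <;> by_cases h' : singVal A i = 0 <;> simp [h, h']

theorem specNorm_mul_truncPinv_le [DecidableEq m] (τ : ℝ) (A : Matrix m n ℝ) :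
    specNorm (A * truncPinv τ A) ≤ 1 :=
  specNorm_le_one_of_isProj (transpose_mul_truncPinv τ A) (mul_truncPinv_mul_self τ A)

theorem specNorm_one_sub_mul_truncPinv_le [DecidableEq m] (τ : ℝ) (A : Matrix m n ℝ) :
    specNorm (1 - A * truncPinv τ A) ≤ 1 := by
  refine specNorm_le_one_of_isProj ?_ ?_
  · rw [Matrix.transpose_sub, transpose_mul_truncPinv, Matrix.transpose_one]
  · rw [Matrix.sub_mul, Matrix.mul_sub, Matrix.mul_sub, mul_truncPinv_mul_self]
    simp

/-- Only singular values below `τ` survive; the identity `‖M‖² = ‖Mᵀ M‖` reduces this to a function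
of `Aᵀ A`. -/
theorem specNorm_one_sub_mul_truncPinv_mul_le [DecidableEq m] {τ : ℝ} (hτ : 0 ≤ τ)
    (A : Matrix m n ℝ) : specNorm ((1 - A * truncPinv τ A) * A) ≤ τ := by
  have e : (1 - A * truncPinv τ A) * A =
      A * rightCalc A (fun i => 1 - if τ ≤ singVal A i ∧ singVal A i ≠ 0 then 1 else 0) := by
    rw [← rightCalc_sub, rightCalc_one, ← truncPinv_mul_self, Matrix.sub_mul, Matrix.mul_sub]
    simp only [Matrix.mul_assoc, Matrix.one_mul, Matrix.mul_one]
  have h := specNorm_transpose_mul_self ((1 - A * truncPinv τ A) * A)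
  rw [e, Matrix.transpose_mul, rightCalc_transpose, Matrix.mul_assoc, ← Matrix.mul_assoc Aᵀ,
    transpose_mul_self_eq_rightCalc, rightCalc_mul, rightCalc_mul, ← e] at h
  rw [← sq_le_sq₀ (specNorm_nonneg _) hτ, ← h]
  refine specNorm_rightCalc_le A (sq_nonneg τ) fun i => ?_
  have h0 := singVal_nonneg A i
  by_cases h1 : τ ≤ singVal A i
  · by_cases h2 : singVal A i = 0
    · simp [h2]; positivity
    · simp [h1, h2]; positivity
  · simp only [h1, false_and, if_false, sub_zero, one_mul, mul_one]
    rw [abs_of_nonneg (sq_nonneg _)]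
    exact pow_le_pow_left₀ h0 (not_le.1 h1).le 2

/-- Truncating amounts to multiplying `pinv A` by a spectral projection of `Aᵀ A`, so `c` bounds
every truncated pseudoinverse. -/
theorem specNorm_truncPinv_le_pinv [DecidableEq m] (τ : ℝ) (A : Matrix m n ℝ) :
    specNorm (truncPinv τ A) ≤ specNorm (pinv A) := by
  have e : truncPinv τ A =
      rightCalc A (fun i => if τ ≤ singVal A i then 1 else 0) * pinv A := by
    rw [pinv, truncPinv_eq_rightCalc, truncPinv_eq_rightCalc, ← Matrix.mul_assoc, rightCalc_mul]
    congr 2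
    funext i
    by_cases h : τ ≤ singVal A i <;> simp [h, singVal_nonneg]
  rw [e]
  refine (specNorm_mul_le _ _).trans (mul_le_of_le_one_left (specNorm_nonneg _) ?_)
  refine specNorm_rightCalc_le A zero_le_one fun i => ?_
  split_ifs <;> simp

/-- Every retained singular value is at least `τ`. The product form also covers `τ = 0`. This
inequality tames the quadratic error term. -/
theorem specNorm_truncPinv_mul_le_one [DecidableEq m] {τ : ℝ} (hτ : 0 ≤ τ) (A : Matrix m n ℝ) :
    specNorm (truncPinv τ A) * τ ≤ 1 := by
  rcases hτ.eq_or_lt with rfl | hτ'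
  · simp
  have h := specNorm_transpose_mul_self (truncPinv τ A)ᵀ
  rw [Matrix.transpose_transpose, specNorm_transpose] at h
  have e : truncPinv τ A * (truncPinv τ A)ᵀ =
      rightCalc A (fun i => if τ ≤ singVal A i then (singVal A i ^ 2)⁻¹ else 0) := by
    nth_rw 2 [truncPinv_eq_rightCalc]
    rw [Matrix.transpose_mul, Matrix.transpose_transpose, ← Matrix.mul_assoc, truncPinv_mul_self,
      rightCalc_transpose, rightCalc_mul]
    congr 1
    funext i
    by_cases h : τ ≤ singVal A i <;> by_cases h' : singVal A i = 0 <;> simp [h, h']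
  rw [e] at h
  have h2 : specNorm (truncPinv τ A) ^ 2 ≤ (τ⁻¹) ^ 2 := by
    rw [← h]
    refine specNorm_rightCalc_le A (sq_nonneg _) fun i => ?_
    split_ifs with h1
    · rw [abs_of_nonneg (by positivity), inv_pow]
      exact inv_anti₀ (by positivity) (pow_le_pow_left₀ hτ h1 2)
    · simp; positivity
  have h3 := (sq_le_sq₀ (specNorm_nonneg _) (by positivity)).1 h2
  calc _ ≤ τ⁻¹ * τ := by gcongr
    _ = 1 := inv_mul_cancel₀ hτ'.ne'

theorem pinv_mul_self_of_rank {A : Matrix m n ℝ} (h : A.rank = Fintype.card n) :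
    pinv A * A = 1 := by
  rw [pinv, truncPinv_mul_self, ← rightCalc_one A]
  congr 1
  funext i
  have hs : singVal A i ≠ 0 := by
    intro h0
    have hr := (Matrix.isHermitian_conjTranspose_mul_self A).rank_eq_card_non_zero_eigs
    rw [Matrix.rank_conjTranspose_mul_self, h] at hr
    have := Fintype.card_subtype_lt
      (p := fun i => (Matrix.isHermitian_conjTranspose_mul_self A).eigenvalues i ≠ 0) (x := i)
      (by rw [← singVal_sq, h0]; simp)
    omega
  simp [hs, singVal_nonneg]

end Pinv

/-! ### The matrix cross approximation with noise -/

section Cross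

variable {m n α β : Type*} [Fintype m] [Fintype n] [Fintype α] [Fintype β]

/-- The intersection of `B` factors through the selected rows of `W` and of `V`; having rank `r`, it
forces both to have full column rank. -/
theorem IsCompactSVD.pinv_mul_submatrix {r : ℕ} {B : Matrix m n ℝ} {W : Matrix m (Fin r) ℝ}
    {σ : Fin r → ℝ} {V : Matrix n (Fin r) ℝ} (h : IsCompactSVD B W σ V) {f : α → m} {g : β → n}
    (hr : (B.submatrix f g).rank = r) :
    pinv (W.submatrix f id) * W.submatrix f id = 1 ∧
      pinv (V.submatrix g id) * V.submatrix g id = 1 := by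
  have hB : B.submatrix f g =
      W.submatrix f id * (Matrix.diagonal σ * (V.submatrix g id)ᵀ) := by
    rw [← Matrix.mul_assoc]
    conv_lhs => rw [h.eq]
    rfl
  constructor
  · apply pinv_mul_self_of_rank
    refine le_antisymm (Matrix.rank_le_card_width _) ((Fintype.card_fin r).trans_le ?_)
    have := Matrix.rank_mul_le_left (W.submatrix f id)
      (Matrix.diagonal σ * (V.submatrix g id)ᵀ)
    rwa [← hB, hr] at this
  · apply pinv_mul_self_of_rank
    refine le_antisymm (Matrix.rank_le_card_width _) ((Fintype.card_fin r).trans_le ?_)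
    have := Matrix.rank_mul_le_right (W.submatrix f id * Matrix.diagonal σ) (V.submatrix g id)ᵀ
    rwa [Matrix.mul_assoc, ← hB, hr, Matrix.rank_transpose] at this

/-- Selected rows of an orthonormal `W` have norm at most one, so a left inverse has norm at least
one. This gives `1 ≤ a`, used to absorb lower-order terms. -/
theorem IsCompactSVD.one_le_specNorm_pinv [DecidableEq m] [DecidableEq α] {r : ℕ}
    {B : Matrix m n ℝ} {W : Matrix m (Fin r) ℝ} {σ : Fin r → ℝ} {V : Matrix n (Fin r) ℝ}
    (h : IsCompactSVD B W σ V) {f : α → m} {g : β → n}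
    (hf : f.Injective) (hr : (B.submatrix f g).rank = r) (h1 : 1 ≤ r) :
    1 ≤ specNorm (pinv (W.submatrix f id)) := by
  have hW1 := (h.pinv_mul_submatrix hr).1
  have : Nonempty (Fin r) := ⟨⟨0, h1⟩⟩
  calc (1 : ℝ) ≤ specNorm (1 : Matrix (Fin r) (Fin r) ℝ) := one_le_specNorm_one
    _ ≤ specNorm (pinv (W.submatrix f id)) * specNorm (W.submatrix f id) := by
        rw [← hW1]; exact specNorm_mul_le _ _
    _ ≤ _ := mul_le_of_le_one_right (specNorm_nonneg _)
        (specNorm_submatrix_le_one h.left_orthonormal hf)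

variable [DecidableEq n] [DecidableEq α] [DecidableEq β]

/-- The part of the matrix that the truncation of the singular values discards. -/
theorem frobNorm_truncation_le {r : ℕ} {B : Matrix m n ℝ} {W : Matrix m (Fin r) ℝ}
    {σ : Fin r → ℝ} {V : Matrix n (Fin r) ℝ} (h : IsCompactSVD B W σ V) {f : α → m} {g : β → n}
    {Y : Matrix β n ℝ} (hBY : B.submatrix id g * Y = B) {a δ τ : ℝ} (hY : specNorm Y ≤ a)
    {U : Matrix α β ℝ} (hU : frobNorm (U - B.submatrix f g) ≤ δ) (hτ : 0 ≤ τ) :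
    frobNorm ((1 - U * truncPinv τ U) * U * Y) ≤ a * (√r * (τ + δ) + δ) := by
  set P := 1 - U * truncPinv τ U with hP
  have hP1 : specNorm P ≤ 1 := specNorm_one_sub_mul_truncPinv_le τ U
  have hPU : specNorm (P * U) ≤ τ := specNorm_one_sub_mul_truncPinv_mul_le hτ U
  clear_value P
  have ha : 0 ≤ a := (specNorm_nonneg Y).trans hY
  have hδ : 0 ≤ δ := (frobNorm_nonneg _).trans hU
  have hVt : specNorm Vᵀ ≤ 1 := by
    rw [specNorm_transpose]
    exact specNorm_le_one_of_orthonormal h.right_orthonormal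
  have hBf : B.submatrix f g * Y = B.submatrix f id := by
    conv_rhs => rw [← hBY]
    rfl
  have hBV : B.submatrix f id * V * Vᵀ = B.submatrix f id := by
    have : B * V * Vᵀ = B := by
      rw [h.eq, Matrix.mul_assoc _ Vᵀ V, h.right_orthonormal, Matrix.mul_one]
    conv_rhs => rw [← this]
    rfl
  have hPD : specNorm (P * (U - B.submatrix f g)) ≤ δ :=
    (specNorm_mul_le _ _).trans <| (mul_le_of_le_one_left (specNorm_nonneg _) hP1).trans <|
      (specNorm_le_frobNorm _).trans hU
  have hPB : specNorm (P * B.submatrix f g) ≤ τ + δ := by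
    have e : P * B.submatrix f g = P * U - P * (U - B.submatrix f g) := by
      rw [Matrix.mul_sub]; abel
    rw [e]
    exact (specNorm_sub_le _ _).trans (add_le_add hPU hPD)
  -- Inserting `V Vᵀ` makes the main term pass through `r` columns, so going from spectral to
  -- Frobenius norm costs `√r` rather than the square root of the matrix size.
  have e : P * U * Y = P * B.submatrix f g * Y * V * Vᵀ + P * (U - B.submatrix f g) * Y := by
    have : P * B.submatrix f g * Y * V * Vᵀ = P * B.submatrix f g * Y := by
      rw [Matrix.mul_assoc P, hBf, Matrix.mul_assoc P, Matrix.mul_assoc P, hBV]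
    rw [this, Matrix.mul_sub, Matrix.sub_mul]
    abel
  rw [e]
  refine (frobNorm_add_le _ _).trans ?_
  have b1 : frobNorm (P * B.submatrix f g * Y * V * Vᵀ) ≤ √r * ((τ + δ) * a) := by
    refine (frobNorm_mul_le_right _ _).trans <|
      (mul_le_of_le_one_right (frobNorm_nonneg _) hVt).trans ?_
    refine (frobNorm_le_sqrt_card_mul_specNorm _).trans ?_
    rw [Fintype.card_fin]
    refine mul_le_mul_of_nonneg_left ?_ (Real.sqrt_nonneg _)
    refine (specNorm_mul_le _ _).trans ?_
    rw [specNorm_transpose] at hVt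
    refine (mul_le_of_le_one_right (specNorm_nonneg _) hVt).trans ?_
    exact (specNorm_mul_le _ _).trans (mul_le_mul hPB hY (specNorm_nonneg _) (by positivity))
  have b2 : frobNorm (P * (U - B.submatrix f g) * Y) ≤ δ * a := by
    refine (frobNorm_mul_le_right _ _).trans (mul_le_mul ?_ hY (specNorm_nonneg _) hδ)
    exact (frobNorm_mul_le_left _ _).trans <|
      (mul_le_of_le_one_left (frobNorm_nonneg _) hP1).trans hU
  linarith

variable [DecidableEq m]

/-- Row and column interpolation of the compact singular value decomposition `B = W diag(σ) Vᵀ`: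
the rows and columns selected by `f` and `g` reproduce `B`. -/
theorem IsCompactSVD.exists_interpolation {r : ℕ} {B : Matrix m n ℝ} {W : Matrix m (Fin r) ℝ}
    {σ : Fin r → ℝ} {V : Matrix n (Fin r) ℝ} (h : IsCompactSVD B W σ V) {f : α → m} {g : β → n}
    (hr : (B.submatrix f g).rank = r) {a : ℝ}
    (hW : specNorm (pinv (W.submatrix f id)) ≤ a) (hV : specNorm (pinv (V.submatrix g id)) ≤ a) :
    ∃ (X : Matrix m α ℝ) (Y : Matrix β n ℝ), specNorm X ≤ a ∧ specNorm Y ≤ a ∧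
      X * B.submatrix f id = B ∧ B.submatrix id g * Y = B := by
  obtain ⟨hW1, hV1⟩ := h.pinv_mul_submatrix hr
  have hV2 : (V.submatrix g id)ᵀ * (pinv (V.submatrix g id))ᵀ = 1 := by
    rw [← Matrix.transpose_mul, hV1, Matrix.transpose_one]
  refine ⟨W * pinv (W.submatrix f id), (pinv (V.submatrix g id))ᵀ * Vᵀ, ?_, ?_, ?_, ?_⟩
  · refine (specNorm_mul_le _ _).trans (le_trans ?_ hW)
    exact mul_le_of_le_one_left (specNorm_nonneg _)
      (specNorm_le_one_of_orthonormal h.left_orthonormal)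
  · refine (specNorm_mul_le _ _).trans (le_trans ?_ hV)
    rw [specNorm_transpose, specNorm_transpose]
    exact mul_le_of_le_one_right (specNorm_nonneg _)
      (specNorm_le_one_of_orthonormal h.right_orthonormal)
  · have e : B.submatrix f id = W.submatrix f id * (Matrix.diagonal σ * Vᵀ) := by
      rw [← Matrix.mul_assoc]
      conv_lhs => rw [h.eq]
      rfl
    rw [e, Matrix.mul_assoc, ← Matrix.mul_assoc _ (W.submatrix f id), hW1, Matrix.one_mul, h.eq,
      Matrix.mul_assoc]
  · have e : B.submatrix id g = W * Matrix.diagonal σ * (V.submatrix g id)ᵀ := by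
      conv_lhs => rw [h.eq]
      rfl
    rw [e, Matrix.mul_assoc, ← Matrix.mul_assoc _ _ Vᵀ, hV2, Matrix.one_mul, h.eq]

/-- The error of a cross approximation of `A`, a perturbation of a matrix `B` of rank `r`, in which
the columns and rows of `A` are replaced by those of approximations `P` and `Q` of `A`. -/
theorem frobNorm_sub_cross_le {r : ℕ} {A B : Matrix m n ℝ} {W : Matrix m (Fin r) ℝ}
    {σ : Fin r → ℝ} {V : Matrix n (Fin r) ℝ} (h : IsCompactSVD B W σ V) {f : α → m} {g : β → n}
    (hf : f.Injective) (hg : g.Injective) (hr : (B.submatrix f g).rank = r) {a c δ τ x z : ℝ}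
    (hW : specNorm (pinv (W.submatrix f id)) ≤ a) (hV : specNorm (pinv (V.submatrix g id)) ≤ a)
    (ha : 1 ≤ a) (hA : frobNorm (A - B) ≤ δ) (hc : specNorm (pinv (A.submatrix f g)) ≤ c)
    (hτ : 0 ≤ τ) {P Q : Matrix m n ℝ} (hP : frobNorm (A - P) ≤ x) (hQ : frobNorm (A - Q) ≤ x)
    (hz : z = if τ = 0 then 0 else a ^ 2 * (√r * (τ + δ) + δ)) :
    frobNorm (A - P.submatrix id g * truncPinv τ (A.submatrix f g) * Q.submatrix f id) ≤
      z + 6 * a ^ 2 * δ + 4 * a ^ 2 * c * δ ^ 2 + 2 * (a + 2 * a * c * δ) * x +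
        specNorm (truncPinv τ (A.submatrix f g)) * x ^ 2 := by
  obtain ⟨X, Y, hX, hY, hXB, hBY⟩ := h.exists_interpolation hr hW hV
  set U := A.submatrix f g with hU
  set K := truncPinv τ U with hK
  have hδ : 0 ≤ δ := (frobNorm_nonneg _).trans hA
  have hx : 0 ≤ x := (frobNorm_nonneg _).trans hP
  have ha0 : 0 ≤ a := zero_le_one.trans ha
  have hc0 : 0 ≤ c := (specNorm_nonneg _).trans hc
  have hKc : specNorm K ≤ c := (specNorm_truncPinv_le_pinv τ U).trans hc
  have hUK : specNorm (U * K) ≤ 1 := specNorm_mul_truncPinv_le τ U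
  have hKU : specNorm (K * U) ≤ 1 := specNorm_truncPinv_mul_self_le τ U
  obtain ⟨D, hD⟩ : ∃ D, D = A - B := ⟨_, rfl⟩
  have hDfg : frobNorm (D.submatrix f g) ≤ δ :=
    (frobNorm_submatrix_le D hf hg).trans (hD ▸ hA)
  have hDg : frobNorm (D.submatrix id g) ≤ δ :=
    (frobNorm_submatrix_le D Function.injective_id hg).trans (hD ▸ hA)
  have hDf : frobNorm (D.submatrix f id) ≤ δ :=
    (frobNorm_submatrix_le D hf Function.injective_id).trans (hD ▸ hA)
  have hXBg : X * B.submatrix f g = B.submatrix id g := by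
    conv_rhs => rw [← hXB]
    rfl
  have hBYf : B.submatrix f g * Y = B.submatrix f id := by
    conv_rhs => rw [← hBY]
    rfl
  have hUD : U = B.submatrix f g + D.submatrix f g := by
    rw [hU, hD]; ext; simp
  -- `G` and `H` are the defects of `A` under the interpolation operators, which are exact for `B`;
  -- only the noise `D` contributes.
  obtain ⟨G, hG⟩ : ∃ G, G = D.submatrix id g - X * D.submatrix f g := ⟨_, rfl⟩
  obtain ⟨H, hH⟩ : ∃ H, H = D.submatrix f id - D.submatrix f g * Y := ⟨_, rfl⟩
  have hGn : frobNorm G ≤ 2 * a * δ := by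
    rw [hG]
    refine (frobNorm_sub_le _ _).trans ?_
    have := (frobNorm_mul_le_left X (D.submatrix f g)).trans
      (mul_le_mul hX hDfg (frobNorm_nonneg _) ha0)
    nlinarith
  have hHn : frobNorm H ≤ 2 * a * δ := by
    rw [hH]
    refine (frobNorm_sub_le _ _).trans ?_
    have := (frobNorm_mul_le_right (D.submatrix f g) Y).trans
      (mul_le_mul hDfg hY (specNorm_nonneg _) hδ)
    nlinarith
  have hC : A.submatrix id g = X * U + G := by
    rw [hUD, Matrix.mul_add, hXBg, hG, hD]; ext; simp
  have hR : A.submatrix f id = U * Y + H := by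
    rw [hUD, Matrix.add_mul, hBYf, hH, hD]; ext; simp
  have hBXY : B = X * U * Y - X * D.submatrix f g * Y := by
    rw [hUD, Matrix.mul_add, hXBg, Matrix.add_mul, hBY]; abel
  obtain ⟨p, hp⟩ : ∃ p, p = (A - P).submatrix id g := ⟨_, rfl⟩
  obtain ⟨q, hq⟩ : ∃ q, q = (A - Q).submatrix f id := ⟨_, rfl⟩
  have hpn : frobNorm p ≤ x :=
    hp ▸ (frobNorm_submatrix_le _ Function.injective_id hg).trans hP
  have hqn : frobNorm q ≤ x :=
    hq ▸ (frobNorm_submatrix_le _ hf Function.injective_id).trans hQ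
  have hPg : P.submatrix id g = X * U + G - p := by
    rw [← hC, hp]; ext; simp
  have hQf : Q.submatrix f id = U * Y + H - q := by
    rw [← hR, hq]; ext; simp
  -- Every `K` is kept next to `U` where possible, since `U K` and `K U` have norm at most one; the
  -- constant `c` enters only where `K` stands next to `G` or `H`.
  have key : A - P.submatrix id g * K * Q.submatrix f id =
      D - X * D.submatrix f g * Y + X * ((1 - U * K) * U * Y) - X * (U * K * H)
        - G * (K * U) * Y - G * K * H + p * (K * U * Y + K * H) + (X * (U * K) + G * K) * q
        - p * K * q := by
    have : A = D + (X * U * Y - X * D.submatrix f g * Y) := by rw [← hBXY, hD]; abel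
    rw [hPg, hQf]
    conv_lhs => rw [this]
    simp only [Matrix.mul_add, Matrix.add_mul, Matrix.mul_sub, Matrix.sub_mul, Matrix.one_mul,
      Matrix.mul_assoc]
    abel
  have b1 : frobNorm D ≤ δ := hD ▸ hA
  have b2 : frobNorm (X * D.submatrix f g * Y) ≤ a * δ * a := by
    refine (frobNorm_mul_le_right _ _).trans (mul_le_mul ?_ hY (specNorm_nonneg _) (by positivity))
    exact (frobNorm_mul_le_left _ _).trans (mul_le_mul hX hDfg (frobNorm_nonneg _) ha0)
  have b3 : frobNorm (X * ((1 - U * K) * U * Y)) ≤ z := by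
    rw [hz]
    split_ifs with h0
    -- At threshold zero the full pseudoinverse satisfies `U K U = U`, so nothing is lost.
    · have h1 := specNorm_one_sub_mul_truncPinv_mul_le hτ U
      rw [← hK] at h1
      have h2 : (1 - U * K) * U = 0 :=
        specNorm_eq_zero (le_antisymm (h1.trans h0.le) (specNorm_nonneg _))
      rw [h2, Matrix.zero_mul, Matrix.mul_zero, frobNorm_zero]
    · have h1 := frobNorm_truncation_le h hBY (f := f) hY (U := U) (δ := δ) (τ := τ)
        (by rw [hUD, add_sub_cancel_left]; exact hDfg) hτ
      calc _ ≤ a * (a * (√r * (τ + δ) + δ)) := (frobNorm_mul_le_left _ _).trans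
            (mul_le_mul hX h1 (frobNorm_nonneg _) ha0)
        _ = _ := by ring
  have b4 : frobNorm (X * (U * K * H)) ≤ a * (1 * (2 * a * δ)) := by
    refine (frobNorm_mul_le_left _ _).trans (mul_le_mul hX ?_ (frobNorm_nonneg _) ha0)
    exact (frobNorm_mul_le_left _ _).trans (mul_le_mul hUK hHn (frobNorm_nonneg _) zero_le_one)
  have b5 : frobNorm (G * (K * U) * Y) ≤ 2 * a * δ * 1 * a := by
    refine (frobNorm_mul_le_right _ _).trans (mul_le_mul ?_ hY (specNorm_nonneg _) (by positivity))
    exact (frobNorm_mul_le_right _ _).trans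
      (mul_le_mul hGn hKU (specNorm_nonneg _) (by positivity))
  have b6 : frobNorm (G * K * H) ≤ 2 * a * δ * c * (2 * a * δ) := by
    refine (frobNorm_mul_le _ _).trans (mul_le_mul ?_ hHn (frobNorm_nonneg _) (by positivity))
    exact (frobNorm_mul_le_right _ _).trans
      (mul_le_mul hGn hKc (specNorm_nonneg _) (by positivity))
  have s1 : specNorm (K * U * Y + K * H) ≤ a + 2 * a * c * δ := by
    refine (specNorm_add_le _ _).trans (add_le_add ?_ ?_)
    · exact (specNorm_mul_le _ _).trans <| (mul_le_of_le_one_left (specNorm_nonneg _) hKU).trans hY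
    · calc _ ≤ c * (2 * a * δ) := (specNorm_mul_le _ _).trans
            (mul_le_mul hKc ((specNorm_le_frobNorm _).trans hHn) (specNorm_nonneg _) hc0)
        _ = _ := by ring
  have s2 : specNorm (X * (U * K) + G * K) ≤ a + 2 * a * c * δ := by
    refine (specNorm_add_le _ _).trans (add_le_add ?_ ?_)
    · exact (specNorm_mul_le _ _).trans <| (mul_le_of_le_one_right (specNorm_nonneg _) hUK).trans hX
    · calc _ ≤ 2 * a * δ * c := (specNorm_mul_le _ _).trans
            (mul_le_mul ((specNorm_le_frobNorm _).trans hGn) hKc (specNorm_nonneg _)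
              (by positivity))
        _ = _ := by ring
  have b7 : frobNorm (p * (K * U * Y + K * H)) ≤ x * (a + 2 * a * c * δ) :=
    (frobNorm_mul_le_right _ _).trans (mul_le_mul hpn s1 (specNorm_nonneg _) hx)
  have b8 : frobNorm ((X * (U * K) + G * K) * q) ≤ (a + 2 * a * c * δ) * x :=
    (frobNorm_mul_le_left _ _).trans (mul_le_mul s2 hqn (frobNorm_nonneg _) (by positivity))
  -- Here `‖K‖` is not replaced by `c`: it will be played off against the threshold.
  have b9 : frobNorm (p * K * q) ≤ x * specNorm K * x := by
    refine (frobNorm_mul_le _ _).trans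
      (mul_le_mul ?_ hqn (frobNorm_nonneg _) (mul_nonneg hx (specNorm_nonneg _)))
    exact (frobNorm_mul_le_right _ _).trans
      (mul_le_mul_of_nonneg_right hpn (specNorm_nonneg _))
  rw [key]
  have t := (frobNorm_sub_le (D - X * D.submatrix f g * Y + X * ((1 - U * K) * U * Y)
    - X * (U * K * H) - G * (K * U) * Y - G * K * H + p * (K * U * Y + K * H)
    + (X * (U * K) + G * K) * q) (p * K * q)).trans <| add_le_add ((frobNorm_add_le _ _).trans <|
    add_le_add ((frobNorm_add_le _ _).trans <| add_le_add ((frobNorm_sub_le _ _).trans <|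
    add_le_add ((frobNorm_sub_le _ _).trans <| add_le_add ((frobNorm_sub_le _ _).trans <|
    add_le_add ((frobNorm_add_le _ _).trans <| add_le_add ((frobNorm_sub_le _ _).trans <|
    add_le_add b1 b2) b3) b4) b5) b6) b7) b8) b9
  -- The six copies of `a² δ` are one each from `b1` and `b2` and two each from `b4` and `b5`.
  have ha2 : δ ≤ a ^ 2 * δ := le_mul_of_one_le_left hδ (one_le_pow₀ ha)
  nlinarith

end Cross

/-! ### The cross product of tensors -/

section Tensors

variable {N : ℕ} {d : Fin N → ℕ}

/-- The multi-index with the given first `k` and remaining components. -/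
def glue {k : ℕ} (a : LeftIdx d k) (b : RightIdx d k) : ∀ j, Fin (d j) :=
  fun j => if h : (j : ℕ) < k then a ⟨j, h⟩ else b ⟨j, h⟩

/-- The first `k` components of a multi-index. -/
def restrictLeft (i : ∀ j, Fin (d j)) (k : ℕ) : LeftIdx d k := fun j => i j

/-- The components of a multi-index after the `k`-th. -/
def restrictRight (i : ∀ j, Fin (d j)) (k : ℕ) : RightIdx d k := fun j => i j

theorem restrictLeft_glue {k : ℕ} (a : LeftIdx d k) (b : RightIdx d k) :
    restrictLeft (glue a b) k = a := by
  funext j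
  simp [restrictLeft, glue, j.2]

theorem restrictRight_glue {k : ℕ} (a : LeftIdx d k) (b : RightIdx d k) :
    restrictRight (glue a b) k = b := by
  funext j
  have := j.2
  simp [restrictRight, glue, j.2]

theorem restrictLeft_glue_of_le {m n : ℕ} (h : m ≤ n) (i : ∀ j, Fin (d j)) (b : RightIdx d n) :
    restrictLeft (glue (restrictLeft i n) b) m = restrictLeft i m := by
  funext j
  have : (j : Fin N).1 < n := j.2.trans_le h
  simp [restrictLeft, glue, this]

theorem restrictRight_glue_of_le {m n : ℕ} (h : m ≤ n) (i : ∀ j, Fin (d j)) (a : LeftIdx d m) :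
    restrictRight (glue a (restrictRight i m)) n = restrictRight i n := by
  funext j
  have : ¬ (j : Fin N).1 < m := fun h' => j.2 (h'.trans_le h)
  simp [restrictRight, glue, this]

theorem glue_glue {m n : ℕ} (h : m ≤ n) (i : ∀ j, Fin (d j)) (a : LeftIdx d m)
    (b : RightIdx d n) :
    glue a (restrictRight (glue (restrictLeft i n) b) m) =
      glue (restrictLeft (glue a (restrictRight i m)) n) b := by
  funext j
  by_cases h1 : (j : ℕ) < m
  · have h2 := h1.trans_le h
    simp [glue, restrictLeft, h1, h2]
  · by_cases h2 : (j : ℕ) < n <;> simp [glue, restrictLeft, restrictRight, h1, h2]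

theorem tensorNorm_eq_frobNorm_unfolding (T : Tensor d) (k : ℕ) :
    tensorNorm T = frobNorm (unfolding T k) := by
  rw [tensorNorm, frobNorm_eq_sqrt, ← Fintype.sum_prod_type',
    ← (Equiv.piEquivPiSubtypeProd (fun j : Fin N => (j : ℕ) < k) fun j => Fin (d j)).symm.sum_comp]
  rfl

namespace InterpolationSets

variable (I : InterpolationSets d)

/-- The tensor whose `m`-th unfolding is the product of the columns `I^{> m}` of the unfolding of
`X`, the matrix `K m` and the rows `I^{≤ m}` of the unfolding of `Y`. -/
def crossMul (K : ∀ k, Matrix (I.right k) (I.left k) ℝ) (m : ℕ) (X Y : Tensor d) : Tensor d :=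
  fun i => ∑ p : I.right m × I.left m,
    X (glue (restrictLeft i m) p.1.1) * K m p.1 p.2 * Y (glue p.2.1 (restrictRight i m))

variable (K : ∀ k, Matrix (I.right k) (I.left k) ℝ)

/-- This turns a node of the bracketing into a matrix cross approximation with inexact columns and
rows. -/
theorem unfolding_crossMul (m : ℕ) (X Y : Tensor d) : unfolding (I.crossMul K m X Y) m =
    (unfolding X m).submatrix id (Subtype.val : I.right m → RightIdx d m) * K m *
      (unfolding Y m).submatrix (Subtype.val : I.left m → LeftIdx d m) id := by
  ext a b
  change I.crossMul K m X Y (glue a b) = _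
  simp only [crossMul, restrictLeft_glue, restrictRight_glue, Matrix.mul_apply,
    Matrix.submatrix_apply, Finset.sum_mul, id]
  rw [Fintype.sum_prod_type, Finset.sum_comm]
  rfl

/-- In both bracketings the middle factor is read at the same entry: modes up to `m` from `I^{≤m}`,
modes after `n` from `I^{>n}`, the rest from `i` (`glue_glue`). -/
theorem crossMul_assoc {m n : ℕ} (h : m ≤ n) (X Y Z : Tensor d) :
    I.crossMul K n (I.crossMul K m X Y) Z = I.crossMul K m X (I.crossMul K n Y Z) := by
  funext i
  simp only [crossMul, restrictLeft_glue_of_le h, restrictRight_glue_of_le h, glue_glue h,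
    Finset.sum_mul, Finset.mul_sum]
  rw [Finset.sum_comm]
  refine Finset.sum_congr rfl fun p _ => Finset.sum_congr rfl fun q _ => ?_
  ring

/-- The cross product of `n + 1` copies of `T` at the consecutive cuts after the mode `p + 1`. -/
def crossSeg (T : Tensor d) (p : ℕ) : ℕ → Tensor d
  | 0 => T
  | n + 1 => I.crossMul K (p + n + 1) (crossSeg T p n) T

theorem crossSeg_add (T : Tensor d) (p a b : ℕ) : I.crossSeg K T p (a + b + 1) =
    I.crossMul K (p + a + 1) (I.crossSeg K T p a) (I.crossSeg K T (p + a + 1) b) := by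
  induction b with
  | zero => rfl
  | succ b ih =>
    change I.crossMul K (p + (a + b + 1) + 1) (I.crossSeg K T p (a + b + 1)) T =
      I.crossMul K (p + a + 1) _ (I.crossMul K (p + a + 1 + b + 1) _ T)
    rw [ih, ← crossMul_assoc I K (by omega), show p + (a + b + 1) + 1 = p + a + 1 + b + 1 by omega]

/-- The matrices used in the cross approximation of `T`. -/
def crossPinv (T : Tensor d) (τ : ℕ → ℝ) (k : ℕ) : Matrix (I.right k) (I.left k) ℝ :=
  truncPinv (τ k) (I.inter (unfolding T k))

theorem partialProd_eq_crossSeg (T : Tensor d) (τ : ℕ → ℝ) (i : ∀ j, Fin (d j)) (k : ℕ)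
    (s : I.left 0) (t : I.right (k + 1)) : I.partialProd T τ i k s t =
      I.crossSeg (I.crossPinv T τ) T 0 k (glue (restrictLeft i (k + 1)) t.1) := by
  induction k with
  | zero =>
    simp only [partialProd, slice, crossSeg]
    congr 1
  | succ k ih =>
    rw [crossSeg, Nat.zero_add]
    simp only [partialProd, crossMul, Matrix.mul_apply, Finset.sum_mul, Fintype.sum_prod_type, ih]
    rw [Finset.sum_comm]
    refine Finset.sum_congr rfl fun p _ => Finset.sum_congr rfl fun q _ => ?_
    rw [restrictLeft_glue_of_le (Nat.le_succ _)]
    congr 1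
theorem crossApprox_eq_crossSeg (hN : 1 ≤ N) (T : Tensor d) (τ : ℕ → ℝ) :
    I.crossApprox T τ = I.crossSeg (I.crossPinv T τ) T 0 (N - 1) := by
  obtain ⟨n, rfl⟩ : ∃ n, N = n + 1 := ⟨N - 1, by omega⟩
  funext i
  have hs : IsEmpty {j : Fin (n + 1) // (j : ℕ) < 0} := ⟨fun j => Nat.not_lt_zero _ j.2⟩
  have ht : IsEmpty {j : Fin (n + 1) // ¬ (j : ℕ) < n + 1} := ⟨fun j => j.2 j.1.2⟩
  -- The boundary sets hold only the empty multi-index, so the double sum has a single term.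
  have us : Unique (I.left 0) :=
    { default := ⟨fun j => hs.elim j, by rw [I.left_zero]; exact Finset.mem_univ _⟩
      uniq := fun x => Subtype.ext (Subsingleton.elim _ _) }
  have ut : Unique (I.right (n + 1)) :=
    { default := ⟨fun j => ht.elim j, by rw [I.right_last]; exact Finset.mem_univ _⟩
      uniq := fun x => Subtype.ext (Subsingleton.elim _ _) }
  change ∑ s : I.left 0, ∑ t : I.right (n + 1), I.partialProd T τ i n s t = _
  rw [Fintype.sum_unique, Fintype.sum_unique, partialProd_eq_crossSeg]
  congr 1
  funext j
  simp [glue, restrictLeft, j.2]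

end InterpolationSets

theorem tensorNorm_add_le (T E : Tensor d) : tensorNorm (T + E) ≤ tensorNorm T + tensorNorm E := by
  simp only [fun X : Tensor d => tensorNorm_eq_frobNorm_unfolding X 0]
  exact frobNorm_add_le (unfolding T 0) (unfolding E 0)

theorem tensorNorm_nonneg (T : Tensor d) : 0 ≤ tensorNorm T := Real.sqrt_nonneg _

theorem tensorNorm_sub_comm (T E : Tensor d) : tensorNorm (T - E) = tensorNorm (E - T) := by
  simp only [fun X : Tensor d => tensorNorm_eq_frobNorm_unfolding X 0]
  exact frobNorm_sub_comm (unfolding T 0) (unfolding E 0)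

theorem le_cutMax (hN : 2 ≤ N) (f : ℕ → ℝ) {k : ℕ} (hk : k ∈ Finset.Icc 1 (N - 1)) :
    f k ≤ cutMax hN f := Finset.le_sup' f hk

end Tensors

/-! ### The dyadic recursion -/

/-- Identifies the level of the cut that halves a dyadic block starting at `p`. -/
theorem padicValNat_two_add_two_pow {l p : ℕ} (h : 2 ^ (l + 1) ∣ p) :
    padicValNat 2 (p + 2 ^ l) = l := by
  obtain ⟨j, rfl⟩ := h
  have e : 2 ^ (l + 1) * j + 2 ^ l = 2 ^ l * (2 * j + 1) := by ring
  rw [e, padicValNat.mul (by positivity) (by omega), padicValNat.prime_pow,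
    padicValNat.eq_zero_of_not_dvd (by omega), add_zero]

/-- The error bound for segments of `2 ^ l` modes. -/
def segBound (F e : ℝ) (l : ℕ) : ℝ := if l = 0 then 0 else F ^ (l - 1) * e

section Recursion

variable {F e : ℝ}

theorem segBound_succ (l : ℕ) : segBound F e (l + 1) = F ^ l * e := by simp [segBound]

theorem segBound_nonneg (hF : 1 ≤ F) (he : 0 ≤ e) (l : ℕ) : 0 ≤ segBound F e l := by
  unfold segBound
  split_ifs
  · exact le_rfl
  · positivity

theorem segBound_le_succ (hF : 1 ≤ F) (he : 0 ≤ e) (l : ℕ) :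
    segBound F e l ≤ segBound F e (l + 1) := by
  rw [segBound_succ]
  cases l with
  | zero => simp [segBound, he]
  | succ l =>
    rw [segBound_succ]
    exact mul_le_mul_of_nonneg_right (pow_le_pow_right₀ hF (Nat.le_succ l)) he

/-- A segment starting at a multiple of `2 ^ (l + 1)` with more than `2 ^ l` copies is cut after the
first `2 ^ l`; both parts start at multiples of `2 ^ l`, and the right part may be shorter.
Divisibility makes the cut have valuation exactly `l`, so `step` applies with the bound valid for
both parts. -/
theorem tensorNorm_sub_crossSeg_le {N : ℕ} {d : Fin N → ℕ} (I : InterpolationSets d)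
    (K : ∀ k, Matrix (I.right k) (I.left k) ℝ) (T : Tensor d) (hF : 1 ≤ F) (he : 0 ≤ e)
    (step : ∀ m ∈ Finset.Icc 1 (N - 1), ∀ X Y : Tensor d,
      tensorNorm (T - X) ≤ segBound F e (padicValNat 2 m) →
      tensorNorm (T - Y) ≤ segBound F e (padicValNat 2 m) →
      tensorNorm (T - I.crossMul K m X Y) ≤ segBound F e (padicValNat 2 m + 1))
    (l p n : ℕ) (hp : 2 ^ l ∣ p) (hn : n + 1 ≤ 2 ^ l) (hN : p + n + 1 ≤ N) :
    tensorNorm (T - I.crossSeg K T p n) ≤ segBound F e l := by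
  induction l generalizing p n with
  | zero =>
    -- A single copy is `T` itself, with error zero.
    obtain rfl : n = 0 := by simpa using hn
    simp [InterpolationSets.crossSeg, tensorNorm, segBound]
  | succ l ih =>
    have hp' : 2 ^ l ∣ p := (pow_dvd_pow 2 (Nat.le_succ l)).trans hp
    by_cases hn' : n + 1 ≤ 2 ^ l
    · exact (ih p n hp' hn' hN).trans (segBound_le_succ hF he l)
    · have hpos : 0 < 2 ^ l := by positivity
      have hpow : 2 ^ (l + 1) = 2 ^ l + 2 ^ l := by ring
      obtain ⟨a, ha⟩ : ∃ a, 2 ^ l = a + 1 := ⟨2 ^ l - 1, by omega⟩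
      obtain ⟨b, rfl⟩ : ∃ b, n = a + b + 1 := ⟨n - a - 1, by omega⟩
      have hv : padicValNat 2 (p + a + 1) = l := by
        rw [add_assoc, ← ha]
        exact padicValNat_two_add_two_pow hp
      have h := step (p + a + 1) (Finset.mem_Icc.2 ⟨by omega, by omega⟩)
        (I.crossSeg K T p a) (I.crossSeg K T (p + a + 1) b)
      rw [hv] at h
      rw [InterpolationSets.crossSeg_add]
      refine h (ih p a hp' (by omega) (by omega)) (ih (p + a + 1) b ?_ (by omega) (by omega))
      rw [add_assoc, ← ha]
      exact dvd_add hp' dvd_rfl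

end Recursion

/-- One step of the recursion, with the threshold equal to the error `x` of the factors. -/
theorem step_le {a c ρ δ x z κ s : ℝ} (ha : 1 ≤ a) (hc : 0 ≤ c) (hρ : 1 ≤ ρ) (hδ : 0 ≤ δ)
    (hx : 6 * a ^ 2 * δ + 4 * a ^ 2 * c * δ ^ 2 ≤ x) (hs : s ≤ ρ)
    (hz : z ≤ a ^ 2 * (s * (x + δ) + δ)) (hκ : κ * x ≤ 1) :
    z + 6 * a ^ 2 * δ + 4 * a ^ 2 * c * δ ^ 2 + 2 * (a + 2 * a * c * δ) * x + κ * x ^ 2 ≤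
      7 * (a ^ 2 * ρ + a ^ 2 * c * ρ * δ + a ^ 2 * c ^ 2 * δ ^ 2) * x := by
  have ha2 : a ≤ a ^ 2 := by nlinarith
  have haδ : 0 ≤ a ^ 2 * δ := by positivity
  have hq : 0 ≤ a ^ 2 * c * δ ^ 2 := by positivity
  have hx0 : 0 ≤ x := by linarith
  have h1 : a ^ 2 * δ ≤ x := by linarith
  have haρ : a ≤ a ^ 2 * ρ := ha2.trans (le_mul_of_one_le_right (by positivity) hρ)
  have h2 : a * x ≤ a ^ 2 * ρ * x := mul_le_mul_of_nonneg_right haρ hx0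
  have h3 : x ≤ a ^ 2 * ρ * x := le_mul_of_one_le_left hx0 (ha.trans haρ)
  have h4 : a * c * δ * x ≤ a ^ 2 * c * ρ * δ * x := by
    have := mul_le_mul_of_nonneg_right haρ (by positivity : 0 ≤ c * δ * x)
    linarith
  have h5 : a ^ 2 * (s * (x + δ)) ≤ a ^ 2 * (ρ * (x + δ)) := by gcongr
  have h6 : a ^ 2 * ρ * δ ≤ ρ * x := by
    have := mul_le_mul_of_nonneg_left h1 (zero_le_one.trans hρ)
    linarith
  have h7 : ρ * x ≤ a ^ 2 * ρ * x :=
    mul_le_mul_of_nonneg_right (le_mul_of_one_le_left (by linarith) (one_le_pow₀ ha)) hx0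
  -- This is where the threshold makes the quadratic term linear. The coefficient 7 of `a² ρ x`
  -- collects three units from `z`, one from the exact-factor error, two from the linear term and
  -- one from here.
  have h8 : κ * x ^ 2 ≤ x := by nlinarith
  have h9 : 0 ≤ a ^ 2 * c ^ 2 * δ ^ 2 * x := by positivity
  have h10 : 0 ≤ a ^ 2 * c * ρ * δ * x := by positivity
  linarith

theorem le_two_pow_ceil_logb {N : ℕ} (hN : 2 ≤ N) :
    N ≤ 2 ^ ⌈Real.logb 2 N⌉₊ ∧ 1 ≤ ⌈Real.logb 2 N⌉₊ := by
  have hN' : (2 : ℝ) ≤ N := by exact_mod_cast hN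
  constructor
  · have h : (N : ℝ) ≤ (2 : ℝ) ^ ⌈Real.logb 2 N⌉₊ := by
      rw [← Real.rpow_natCast]
      exact (Real.logb_le_iff_le_rpow one_lt_two (by linarith)).1 (Nat.le_ceil _)
    exact_mod_cast h
  · exact Nat.one_le_ceil_iff.2 (Real.logb_pos one_lt_two (by linarith))

/-- At level zero both factors are exact and the threshold vanishes, leaving `e`; at higher levels
the threshold equals the error bound of the factors and `step_le` gives the factor `F`. -/
theorem tensorNorm_sub_crossMul_le {N : ℕ} {d : Fin N → ℕ} (I : InterpolationSets d) {m r : ℕ}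
    {A X Y : Tensor d} {B : Matrix (LeftIdx d m) (RightIdx d m) ℝ}
    {W : Matrix (LeftIdx d m) (Fin r) ℝ} {σ : Fin r → ℝ} {V : Matrix (RightIdx d m) (Fin r) ℝ}
    (h : IsCompactSVD B W σ V) (hr : (I.inter B).rank = r) {a c δ ρ F e : ℝ} {τ : ℕ → ℝ} {l : ℕ}
    (hW : specNorm (pinv (I.leftRows W)) ≤ a) (hV : specNorm (pinv (I.rightRows V)) ≤ a)
    (ha : 1 ≤ a) (hA : frobNorm (unfolding A m - B) ≤ δ)
    (hc : specNorm (pinv (I.inter (unfolding A m))) ≤ c) (hρ : 1 ≤ ρ) (hrρ : (r : ℝ) ≤ ρ)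
    (hF : F = 7 * (a ^ 2 * ρ + a ^ 2 * c * ρ * δ + a ^ 2 * c ^ 2 * δ ^ 2)) (hF1 : 1 ≤ F)
    (he : e = 6 * a ^ 2 * δ + 4 * a ^ 2 * c * δ ^ 2) (hτ : τ m = segBound F e l)
    (hX : tensorNorm (A - X) ≤ segBound F e l) (hY : tensorNorm (A - Y) ≤ segBound F e l) :
    tensorNorm (A - I.crossMul (I.crossPinv A τ) m X Y) ≤ segBound F e (l + 1) := by
  have hδ : 0 ≤ δ := (frobNorm_nonneg _).trans hA
  have hc0 : 0 ≤ c := (specNorm_nonneg _).trans hc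
  have he0 : 0 ≤ e := by rw [he]; positivity
  have hx0 := segBound_nonneg hF1 he0 l
  rw [tensorNorm_eq_frobNorm_unfolding _ m] at hX hY ⊢
  have key := frobNorm_sub_cross_le h (f := (Subtype.val : I.left m → LeftIdx d m))
    (g := (Subtype.val : I.right m → RightIdx d m)) Subtype.val_injective Subtype.val_injective hr
    hW hV ha hA hc hx0 hX hY rfl
  change frobNorm (unfolding A m - unfolding (I.crossMul (I.crossPinv A τ) m X Y) m) ≤ _
  rw [InterpolationSets.unfolding_crossMul, InterpolationSets.crossPinv, hτ]
  refine key.trans ?_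
  have hκ := specNorm_truncPinv_mul_le_one hx0 (I.inter (unfolding A m))
  cases l with
  | zero =>
    rw [segBound_succ, he]
    simp [segBound]
  | succ l =>
    have hs : √(r : ℝ) ≤ ρ := by
      rw [Real.sqrt_le_left (by linarith)]
      nlinarith
    have hx : e ≤ segBound F e (l + 1) := by
      rw [segBound_succ]
      exact le_mul_of_one_le_left he0 (one_le_pow₀ hF1)
    have := step_le (s := √(r : ℝ)) ha hc0 hρ hδ (he ▸ hx) hs
      (z := if segBound F e (l + 1) = 0 then 0 else a ^ 2 * (√r * (segBound F e (l + 1) + δ) + δ))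
      (by split_ifs; positivity; exact le_rfl) hκ
    rw [← hF] at this
    refine this.trans (le_of_eq ?_)
    rw [segBound_succ, segBound_succ]
    ring

end TTCross

end

/-! ### Choice of thresholds and conclusion -/

theorem mainTheorem3 :
    ∃ C : ℝ, 0 < C ∧
      ∀ (N : ℕ) (hN : 2 ≤ N) (d : Fin N → ℕ) (T E : Tensor d) (r : ℕ → ℕ)
        (Tr : ∀ k : ℕ, Matrix (LeftIdx d k) (RightIdx d k) ℝ)
        (W : ∀ k : ℕ, Matrix (LeftIdx d k) (Fin (r k)) ℝ)
        (σ : ∀ k : ℕ, Fin (r k) → ℝ)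
        (V : ∀ k : ℕ, Matrix (RightIdx d k) (Fin (r k)) ℝ)
        (I : InterpolationSets d),
        (∃ k ∈ Finset.Icc 1 (N - 1), 1 ≤ r k) →
        (∀ k ∈ Finset.Icc 1 (N - 1), IsBestRankApprox (unfolding T k) (r k) (Tr k)) →
        (∀ k ∈ Finset.Icc 1 (N - 1), IsCompactSVD (Tr k) (W k) (σ k) (V k)) →
        (∀ k ∈ Finset.Icc 1 (N - 1), (I.inter (Tr k)).rank = r k) →
        ∀ a c ρ ε δ : ℝ,
          a = cutMax hN (fun k => max (specNorm (pinv (I.leftRows (W k))))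
            (specNorm (pinv (I.rightRows (V k))))) →
          c = cutMax hN (fun k => specNorm (pinv (I.inter (unfolding (T + E) k)))) →
          ρ = cutMax hN (fun k => (r k : ℝ)) →
          ε = cutMax hN (fun k => frobNorm (unfolding T k - Tr k)) →
          δ = ε + tensorNorm E →
          ∃ τ : ℕ → ℝ, (∀ k, 0 ≤ τ k) ∧
            tensorNorm (T - I.crossApprox (T + E) τ) ≤
              (C * (a ^ 2 * ρ + a ^ 2 * c * ρ * δ + a ^ 2 * c ^ 2 * δ ^ 2)) ^
                  (⌈Real.logb 2 N⌉₊ - 1) *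
                (C * (a ^ 2 * δ + a ^ 2 * c * δ ^ 2 + a ^ 2 * c ^ 2 * δ ^ 2)) ∧
            tensorNorm (T - I.crossApprox (T + E) τ) ≤
              (C * (a ^ 2 * ρ + a ^ 2 * c * ρ * δ + a ^ 2 * c ^ 2 * δ ^ 2)) ^
                  (⌈Real.logb 2 N⌉₊ - 1) *
                (C * (a ^ 2 * δ + a ^ 2 * c * δ ^ 2 + a ^ 2 * c ^ 2 * δ ^ 3)) := by
  refine ⟨7, by norm_num, ?_⟩
  intro N hN d T E r Tr W σ V I hr1 _ hsvd hrank a c ρ ε δ ha hc hρ hε hδ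
  have haW : ∀ k ∈ Finset.Icc 1 (N - 1), specNorm (pinv (I.leftRows (W k))) ≤ a := fun k hk =>
    (le_max_left _ _).trans (ha ▸ le_cutMax hN (fun k => max (specNorm (pinv (I.leftRows (W k))))
      (specNorm (pinv (I.rightRows (V k))))) hk)
  have haV : ∀ k ∈ Finset.Icc 1 (N - 1), specNorm (pinv (I.rightRows (V k))) ≤ a := fun k hk =>
    (le_max_right _ _).trans (ha ▸ le_cutMax hN (fun k => max (specNorm (pinv (I.leftRows (W k))))
      (specNorm (pinv (I.rightRows (V k))))) hk)
  have hck : ∀ k ∈ Finset.Icc 1 (N - 1),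
      specNorm (pinv (I.inter (unfolding (T + E) k))) ≤ c := fun k hk =>
    hc ▸ le_cutMax hN (fun k => specNorm (pinv (I.inter (unfolding (T + E) k)))) hk
  have hrk : ∀ k ∈ Finset.Icc 1 (N - 1), (r k : ℝ) ≤ ρ := fun k hk =>
    hρ ▸ le_cutMax hN (fun k => (r k : ℝ)) hk
  have hεk : ∀ k ∈ Finset.Icc 1 (N - 1), frobNorm (unfolding T k - Tr k) ≤ ε := fun k hk =>
    hε ▸ le_cutMax hN (fun k => frobNorm (unfolding T k - Tr k)) hk
  obtain ⟨k₀, hk₀, hr₀⟩ := hr1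
  have ha1 : 1 ≤ a := ((hsvd k₀ hk₀).one_le_specNorm_pinv Subtype.val_injective
    (hrank k₀ hk₀) hr₀).trans (haW k₀ hk₀)
  have hρ1 : 1 ≤ ρ := le_trans (by exact_mod_cast hr₀) (hrk k₀ hk₀)
  have hc0 : 0 ≤ c := (specNorm_nonneg _).trans (hck k₀ hk₀)
  have hε0 : 0 ≤ ε := (frobNorm_nonneg _).trans (hεk k₀ hk₀)
  have hEδ : tensorNorm E ≤ δ := by linarith
  have hδ0 : 0 ≤ δ := (tensorNorm_nonneg E).trans hEδ
  have hδk : ∀ k ∈ Finset.Icc 1 (N - 1), frobNorm (unfolding (T + E) k - Tr k) ≤ δ := by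
    intro k hk
    have e : unfolding (T + E) k - Tr k = (unfolding T k - Tr k) + unfolding E k := by
      change unfolding T k + unfolding E k - Tr k = _
      abel
    rw [e, hδ, tensorNorm_eq_frobNorm_unfolding E k]
    exact (frobNorm_add_le _ _).trans (add_le_add (hεk k hk) le_rfl)
  set F : ℝ := 7 * (a ^ 2 * ρ + a ^ 2 * c * ρ * δ + a ^ 2 * c ^ 2 * δ ^ 2) with hF
  have hF1 : 1 ≤ F := by
    have h1 : 1 ≤ a ^ 2 * ρ := one_le_mul_of_one_le_of_one_le (one_le_pow₀ ha1) hρ1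
    have h2 : 0 ≤ a ^ 2 * c * ρ * δ := by positivity
    have h3 : 0 ≤ a ^ 2 * c ^ 2 * δ ^ 2 := by positivity
    linarith
  obtain ⟨e, he⟩ : ∃ e, e = 6 * a ^ 2 * δ + 4 * a ^ 2 * c * δ ^ 2 := ⟨_, rfl⟩
  have he0 : 0 ≤ e := by rw [he]; positivity
  obtain ⟨hL, hL1⟩ := le_two_pow_ceil_logb hN
  set L := ⌈Real.logb 2 N⌉₊ with hLdef
  -- The threshold at a cut is the error bound of the two segments it joins.
  let τ : ℕ → ℝ := fun k => segBound F e (padicValNat 2 k)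
  refine ⟨τ, fun k => segBound_nonneg hF1 he0 _, ?_⟩
  have hseg : tensorNorm (T + E - I.crossApprox (T + E) τ) ≤ segBound F e L := by
    rw [I.crossApprox_eq_crossSeg (by omega)]
    exact tensorNorm_sub_crossSeg_le I _ (T + E) hF1 he0
      (fun m hm X Y hX hY => tensorNorm_sub_crossMul_le I (hsvd m hm) (hrank m hm) (haW m hm)
        (haV m hm) ha1 (hδk m hm) (hck m hm) hρ1 (hrk m hm) hF hF1 he rfl hX hY)
      L 0 (N - 1) (dvd_zero _) (by omega) (by omega)
  have hT : tensorNorm (T - I.crossApprox (T + E) τ) ≤ F ^ (L - 1) * (e + δ) := by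
    have e1 : T - I.crossApprox (T + E) τ = (T + E - I.crossApprox (T + E) τ) + (0 - E) := by
      abel
    have e2 : tensorNorm (0 - E) = tensorNorm E := by rw [tensorNorm_sub_comm, sub_zero]
    have e3 : segBound F e L = F ^ (L - 1) * e := by
      conv_lhs => rw [← Nat.sub_add_cancel hL1]
      rw [segBound_succ]
    -- The measurement error enters once more, outside the recursion, and is absorbed using `1 ≤ F`.
    have e4 : δ ≤ F ^ (L - 1) * δ := le_mul_of_one_le_left hδ0 (one_le_pow₀ hF1)
    have h := tensorNorm_add_le (T + E - I.crossApprox (T + E) τ) (0 - E)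
    rw [← e1, e2] at h
    rw [mul_add]
    linarith
  have hFp : 0 ≤ F ^ (L - 1) := by positivity
  have hδa : δ ≤ a ^ 2 * δ := le_mul_of_one_le_left hδ0 (one_le_pow₀ ha1)
  have h1 : 0 ≤ a ^ 2 * c * δ ^ 2 := by positivity
  have h2 : 0 ≤ a ^ 2 * c ^ 2 * δ ^ 2 := by positivity
  have h3 : 0 ≤ a ^ 2 * c ^ 2 * δ ^ 3 := by positivity
  -- Since `e + δ ≤ 7 a² δ + 4 a² c δ²`, the term in `c² δ ^ p` is only nonnegative slack, and both
  -- exponents follow from the same bound.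
  exact ⟨hT.trans (mul_le_mul_of_nonneg_left (by linarith) hFp),
    hT.trans (mul_le_mul_of_nonneg_left (by linarith) hFp)⟩
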